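/- Assume the Continuum Hypothesis ($\aleph_1 = 2^{\aleph_0}$). Banach spaces are taken over a fixed scalar field, $\mathbb R$ or $\mathbb C$, and operators are continuous and linear. For a set $\Gamma$, $c_0(\Gamma)$ is the Banach space, with the supremum norm, of all scalar functions on $\Gamma$ that vanish at infinity, and $c_0=c_0(\mathbb N)$. A Banach space $X$ is a twisted sum of Banach spaces $Y$ and $Z$ if there is a short exact sequence of Banach spaces and operators $0\to Y\to X\to Z\to 0$. Such a sequence splits if the image of $Y$ is complemented in $X$, and $\operatorname{Ext}(Z,Y)=0$ means that every short exact sequence of Banach spaces $0\to Y\to E\to Z\to 0$ splits. Let $J_0$ and $\Gamma_n$ $(n\ge 0)$ be arbitrary sets, and let $(X_n)_{n\ge 0}$ be a sequence of Banach spaces such that $X_0$ is nonseparable and is a twisted sum of $c_0(\Gamma_0)$ and $c_0(J_0)$, and such that, for every $n\ge 1$, $X_n$ is a twisted sum of $c_0(\Gamma_n)$ and $X_{n-1}$. Then $\operatorname{Ext}(X_n,c_0)\neq 0$ for every $n\ge 0$, i.e. for every $n\ge 0$ there is a short exact sequence of Banach spaces $0\to c_0\to E\to X_n\to 0$ that does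 not split. -/

import Mathlib

open scoped ZeroAtInfty

universe uk uy ux uz

/-- A sequence of operators `0 ⟶ Y ⟶ X ⟶ Z ⟶ 0` (with `i : Y ⟶ X` and `q : X ⟶ Z` linear and
continuous) is exact: the kernel of each arrow is the image of the preceding one. -/
structure IsShortExactSeq {𝕜 : Type uk} [RCLike 𝕜]
    {Y : Type uy} [NormedAddCommGroup Y] [NormedSpace 𝕜 Y]
    {X : Type ux} [NormedAddCommGroup X] [NormedSpace 𝕜 X]
    {Z : Type uz} [NormedAddCommGroup Z] [NormedSpace 𝕜 Z]
    (i : Y →L[𝕜] X) (q : X →L[𝕜] Z) : Prop where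
  injective : Function.Injective i
  exact : Function.Exact i q
  surjective : Function.Surjective q

/-- The Banach space `X` is a twisted sum of the Banach spaces `Y` and `Z` (in this order): there
is a short exact sequence of operators `0 ⟶ Y ⟶ X ⟶ Z ⟶ 0`. -/
def IsTwistedSum (𝕜 : Type uk) [RCLike 𝕜]
    (Y : Type uy) [NormedAddCommGroup Y] [NormedSpace 𝕜 Y]
    (Z : Type uz) [NormedAddCommGroup Z] [NormedSpace 𝕜 Z]
    (X : Type ux) [NormedAddCommGroup X] [NormedSpace 𝕜 X] : Prop :=
  ∃ (i : Y →L[𝕜] X) (q : X →L[𝕜] Z), IsShortExactSeq i q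

/-- `Ext(Z, Y) = 0`: every short exact sequence of Banach spaces `0 ⟶ Y ⟶ E ⟶ Z ⟶ 0` splits, that
is, the image of `Y` is complemented in `E`. The middle space `E` is in bijection with `Y × Z`, so
there is no loss in letting it range over the universe of `Y × Z`. -/
def ExtEqZero (𝕜 : Type uk) [RCLike 𝕜]
    (Z : Type uz) [NormedAddCommGroup Z] [NormedSpace 𝕜 Z]
    (Y : Type uy) [NormedAddCommGroup Y] [NormedSpace 𝕜 Y] : Prop :=
  ∀ (E : Type (max uy uz)) [NormedAddCommGroup E] [NormedSpace 𝕜 E] [CompleteSpace E]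
    (i : Y →L[𝕜] E) (q : E →L[𝕜] Z), IsShortExactSeq i q →
      (LinearMap.range (i : Y →ₗ[𝕜] E)).ClosedComplemented

/-!
Suppose `Ext(X, c₀) = 0`. Pulling back `0 ⟶ c₀ ⟶ ℓ∞ ⟶ ℓ∞ / c₀ ⟶ 0` along an operator
`X ⟶ ℓ∞ / c₀` gives a sequence that splits, so every such operator lifts to an operator `X ⟶ ℓ∞`
(`ExtEqZero.exists_lift`). The theorem follows by counting: some `X n` would have `2 ^ 𝔠` operators
to `ℓ∞ / c₀` that are told apart by `𝔠` vectors, but only `𝔠` traces of operators to `ℓ∞` on those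
vectors.

*Few operators to `ℓ∞`.* An operator to `ℓ∞` is a bounded sequence of functionals, so it suffices
that the functionals on `X n` have at most `𝔠` restrictions to any set of at most `𝔠` vectors
(`HasFewRestrictions`). For `c₀(Γ)` this holds, whatever the size of `Γ`, because its dual is
`ℓ₁(Γ)` (`hasFewRestrictions_c0`), and it is a three-space property
(`IsShortExactSeq.hasFewRestrictions`). No bound on the density of `X n` is needed.

*Many operators to `ℓ∞ / c₀`.* The branches of the binary tree are an almost disjoint family of
subsets of `ℕ`, and the classes of their indicators span a copy of `c₀(2 ^ ℕ)` in `ℓ∞ / c₀`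
(`norm_sum_branch_le`, `le_norm_sum_branch`). A bounded family of nonzero functionals `f σ`, one for
each branch and tending to `0` pointwise (`HasNullFamily`), thus yields an operator
`x ↦ ∑ σ ∈ S, f σ x • [1_σ]` for each set `S` of branches, and vectors `x σ` with `f σ (x σ) ≠ 0`
tell these operators apart.

*The null family.* It is inherited by `X (n + 1)` from its quotient `X n`. On `X 0` it comes from
the coordinates of `c₀(J₀)` if `J₀` is uncountable. If `J₀` is countable, there is a closed
separable subspace `W` of `X 0` that maps onto `c₀(J₀)`; it meets `c₀(Γ 0)` in vectors with a
common countable support, and every coordinate on `c₀(Γ 0)` outside that support extends to `X 0` by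
`0` on `W` (`IsShortExactSeq.exists_not_countable`). In both cases the family is uncountable, and
the continuum hypothesis allows it to be indexed by the branches.
-/

/-! ### Functions vanishing at infinity on a discrete space -/

section C0

variable {𝕜 : Type*} [RCLike 𝕜] {Γ : Type*} [TopologicalSpace Γ]

theorem ZeroAtInftyContinuousMap.norm_apply_le (φ : C₀(Γ, 𝕜)) (γ : Γ) : ‖φ γ‖ ≤ ‖φ‖ := by
  rw [← ZeroAtInftyContinuousMap.norm_toBCF_eq_norm]
  exact φ.toBCF.norm_coe_le_norm γ

theorem ZeroAtInftyContinuousMap.norm_le_of_forall {φ : C₀(Γ, 𝕜)} {C : ℝ} (hC : 0 ≤ C)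
    (h : ∀ γ, ‖φ γ‖ ≤ C) : ‖φ‖ ≤ C := by
  rw [← ZeroAtInftyContinuousMap.norm_toBCF_eq_norm]
  exact (BoundedContinuousFunction.norm_le hC).2 h

variable [DiscreteTopology Γ]

theorem ZeroAtInftyContinuousMap.finite_le_norm (φ : C₀(Γ, 𝕜)) {ε : ℝ} (hε : 0 < ε) :
    {γ | ε ≤ ‖φ γ‖}.Finite := by
  have h := φ.zero_at_infty'
  rw [Filter.cocompact_eq_cofinite] at h
  have h2 := h.norm.eventually (gt_mem_nhds (by simpa using hε))
  rw [Filter.eventually_cofinite] at h2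
  refine h2.subset fun γ hγ => ?_
  simpa using hγ

/-- A function on a discrete space all of whose superlevel sets `{γ | ε ≤ ‖φ γ‖}`, `ε > 0`, are
finite, as an element of `C₀(Γ, 𝕜)`. -/
def ZeroAtInftyContinuousMap.ofFinite (φ : Γ → 𝕜) (h : ∀ ε > 0, {γ | ε ≤ ‖φ γ‖}.Finite) :
    C₀(Γ, 𝕜) where
  toFun := φ
  continuous_toFun := continuous_of_discreteTopology
  zero_at_infty' := by
    rw [Filter.cocompact_eq_cofinite, tendsto_zero_iff_norm_tendsto_zero, Metric.tendsto_nhds]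
    intro ε hε
    rw [Filter.eventually_cofinite]
    refine (h ε hε).subset fun γ hγ => ?_
    simpa using hγ

@[simp] theorem ZeroAtInftyContinuousMap.ofFinite_apply (φ : Γ → 𝕜)
    (h : ∀ ε > 0, {γ | ε ≤ ‖φ γ‖}.Finite) (γ : Γ) :
    ZeroAtInftyContinuousMap.ofFinite φ h γ = φ γ := rfl

open Classical in
/-- The unit vector of `C₀(Γ, 𝕜)` at `γ`. -/
noncomputable def c0Single (γ : Γ) : C₀(Γ, 𝕜) :=
  ZeroAtInftyContinuousMap.ofFinite (Pi.single γ 1) fun ε hε =>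
    (Set.finite_singleton γ).subset fun δ hδ => by
      by_contra hne
      have hne' : δ ≠ γ := hne
      simp [Pi.single_eq_of_ne hne'] at hδ
      linarith

open Classical in
theorem c0Single_apply (γ δ : Γ) : c0Single (𝕜 := 𝕜) γ δ = if δ = γ then 1 else 0 := by
  simp [c0Single, Pi.single_apply]

theorem sum_smul_c0Single_apply (F : Finset Γ) (a : Γ → 𝕜) (δ : Γ) [Decidable (δ ∈ F)] :
    (∑ γ ∈ F, a γ • c0Single (𝕜 := 𝕜) γ) δ = if δ ∈ F then a δ else 0 := by
  classical
  have h : (∑ γ ∈ F, a γ • c0Single (𝕜 := 𝕜) γ) δ = ∑ γ ∈ F, (a γ • c0Single (𝕜 := 𝕜) γ) δ :=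
    map_sum (⟨⟨fun φ : C₀(Γ, 𝕜) => φ δ, rfl⟩, fun _ _ => rfl⟩ : C₀(Γ, 𝕜) →+ 𝕜) _ _
  rw [h]
  simp [c0Single_apply]

/-- The unit vectors form an unconditional basis of `C₀(Γ, 𝕜)`. -/
theorem hasSum_smul_c0Single (φ : C₀(Γ, 𝕜)) : HasSum (fun γ => φ γ • c0Single γ) φ := by
  classical
  rw [HasSum, SummationFilter.unconditional_filter, Metric.tendsto_nhds]
  intro ε hε
  filter_upwards [Filter.eventually_ge_atTop (φ.finite_le_norm (half_pos hε)).toFinset] with F hF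
  rw [dist_eq_norm]
  refine (ZeroAtInftyContinuousMap.norm_le_of_forall (half_pos hε).le fun δ => ?_).trans_lt
    (half_lt_self hε)
  rw [ZeroAtInftyContinuousMap.sub_apply, sum_smul_c0Single_apply]
  split_ifs with h
  · simpa using (half_pos hε).le
  · have : δ ∉ {γ | ε / 2 ≤ ‖φ γ‖} := fun h' => h (hF (by simpa using h'))
    simp only [Set.mem_ofPred_eq, not_le] at this
    simpa using this.le

/-- A continuous functional on `c₀(Γ)` is nonzero on only countably many unit vectors, because its
values there are absolutely summable. -/
theorem countable_support_apply_c0Single (f : C₀(Γ, 𝕜) →L[𝕜] 𝕜) :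
    (Function.support fun γ => f (c0Single γ)).Countable := by
  classical
  have hs : Summable fun γ => ‖f (c0Single γ)‖ := by
    refine summable_of_sum_le (c := ‖f‖) (fun _ => norm_nonneg _) fun F => ?_
    -- test `f` on the unimodular combination of unit vectors that aligns the phases
    let a : Γ → 𝕜 := fun γ =>
      if f (c0Single γ) = 0 then 0 else (‖f (c0Single γ)‖ : 𝕜) / f (c0Single γ)
    have ha : ∀ γ, ‖a γ‖ ≤ 1 := fun γ => by
      by_cases h : f (c0Single γ) = 0
      · simp [a, h]
      · simp [a, h]
    have haf : ∀ γ, a γ * f (c0Single γ) = (‖f (c0Single γ)‖ : 𝕜) := fun γ => by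
      by_cases h : f (c0Single γ) = 0
      · simp [a, h]
      · simp [a, h]
    have hnorm : ‖∑ γ ∈ F, a γ • c0Single (𝕜 := 𝕜) γ‖ ≤ 1 := by
      refine ZeroAtInftyContinuousMap.norm_le_of_forall zero_le_one fun δ => ?_
      rw [sum_smul_c0Single_apply]
      split_ifs
      · exact ha δ
      · simp
    have hval : f (∑ γ ∈ F, a γ • c0Single (𝕜 := 𝕜) γ)
        = ((∑ γ ∈ F, ‖f (c0Single γ)‖ : ℝ) : 𝕜) := by
      simp [map_sum, haf]
    calc ∑ γ ∈ F, ‖f (c0Single γ)‖ = ‖f (∑ γ ∈ F, a γ • c0Single (𝕜 := 𝕜) γ)‖ := by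
          rw [hval, RCLike.norm_ofReal, abs_of_nonneg (Finset.sum_nonneg fun _ _ => norm_nonneg _)]
      _ ≤ ‖f‖ * 1 := f.le_opNorm_of_le hnorm
      _ = ‖f‖ := mul_one _
  refine hs.countable_support.mono fun γ hγ => ?_
  simpa using hγ

theorem ZeroAtInftyContinuousMap.countable_support (φ : C₀(Γ, 𝕜)) :
    (Function.support φ).Countable := by
  refine (Set.countable_iUnion fun n : ℕ =>
    (φ.finite_le_norm (Nat.one_div_pos_of_nat (n := n))).countable).mono fun γ hγ => ?_
  obtain ⟨n, hn⟩ := exists_nat_one_div_lt (norm_pos_iff.2 hγ)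
  exact Set.mem_iUnion.2 ⟨n, hn.le⟩

/-- Functionals agreeing on the unit vectors in the support of `φ` agree at `φ`. -/
theorem apply_eq_of_eq_c0Single {f g : C₀(Γ, 𝕜) →L[𝕜] 𝕜} {φ : C₀(Γ, 𝕜)}
    (h : ∀ γ, φ γ ≠ 0 → f (c0Single γ) = g (c0Single γ)) : f φ = g φ := by
  have hf := (hasSum_smul_c0Single φ).mapL f
  have hg := (hasSum_smul_c0Single φ).mapL g
  refine hf.unique ?_
  convert hg using 2 with γ
  by_cases hγ : φ γ = 0
  · simp [hγ]
  · simp [h γ hγ]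

theorem separableSpace_c0 [Countable Γ] : TopologicalSpace.SeparableSpace C₀(Γ, 𝕜) := by
  have h : TopologicalSpace.IsSeparable
      (Submodule.span 𝕜 (Set.range (c0Single : Γ → C₀(Γ, 𝕜))) : Set C₀(Γ, 𝕜)) :=
    (Set.countable_range _).isSeparable.span
  rw [← TopologicalSpace.isSeparable_univ_iff]
  refine h.closure.mono fun φ _ => ?_
  refine mem_closure_of_tendsto (hasSum_smul_c0Single φ) (.of_forall fun F => ?_)
  exact Submodule.sum_mem _ fun γ _ =>
    Submodule.smul_mem _ _ (Submodule.subset_span (Set.mem_range_self γ))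

/-- The elements of a separable subset of `c₀(Γ)` have a common countable support. -/
theorem TopologicalSpace.IsSeparable.countable_iUnion_support {B : Set C₀(Γ, 𝕜)}
    (hB : TopologicalSpace.IsSeparable B) : {γ | ∃ φ ∈ B, φ γ ≠ 0}.Countable := by
  obtain ⟨c, hc, hBc⟩ := hB
  refine (hc.biUnion fun φ _ => φ.countable_support).mono ?_
  rintro γ ⟨φ, hφ, hne⟩
  by_contra hγ
  simp only [Set.mem_iUnion, Function.mem_support, not_exists, not_not] at hγ
  have hcl : IsClosed {ψ : C₀(Γ, 𝕜) | ψ γ = 0} := by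
    have : Continuous fun ψ : C₀(Γ, 𝕜) => ψ γ :=
      (LipschitzWith.of_dist_le_mul (K := 1) fun ψ χ => by
        rw [dist_eq_norm, dist_eq_norm]
        simpa using (ψ - χ).norm_apply_le γ).continuous
    exact isClosed_eq this continuous_const
  exact hne (closure_minimal (fun ψ hψ => hγ ψ hψ) hcl (hBc hφ))

end C0

/-! ### Counting restrictions of functionals -/

section Counting

open Cardinal

theorem Cardinal.mk_le_continuum_of_injective {α : Type*} {β : Type*} {f : α → β}
    (hf : Function.Injective f) (h : #β ≤ 𝔠) : #α ≤ 𝔠 :=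
  Cardinal.lift_le_continuum.1
    ((Cardinal.lift_mk_le'.2 ⟨⟨f, hf⟩⟩).trans (Cardinal.lift_le_continuum.2 h))

theorem Cardinal.mk_le_continuum_of_surjective {α : Type*} {β : Type*} {f : α → β}
    (hf : Function.Surjective f) (h : #α ≤ 𝔠) : #β ≤ 𝔠 :=
  Cardinal.mk_le_continuum_of_injective (Function.injective_surjInv hf) h

theorem Cardinal.mk_prod_le_continuum {α : Type*} {β : Type*} (hα : #α ≤ 𝔠) (hβ : #β ≤ 𝔠) :
    #(α × β) ≤ 𝔠 := by
  rw [Cardinal.mk_prod, ← Cardinal.continuum_mul_self]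
  exact mul_le_mul' (Cardinal.lift_le_continuum.2 hα) (Cardinal.lift_le_continuum.2 hβ)

theorem Cardinal.mk_nat_arrow_le_continuum {α : Type*} (hα : #α ≤ 𝔠) : #(ℕ → α) ≤ 𝔠 := by
  rw [Cardinal.mk_arrow, ← Cardinal.continuum_power_aleph0]
  simpa using Cardinal.power_le_power_right (c := ℵ₀) hα

theorem Cardinal.mk_rclike_le_continuum (𝕜 : Type*) [RCLike 𝕜] : #𝕜 ≤ 𝔠 := by
  refine Cardinal.mk_le_continuum_of_injective (f := fun z : 𝕜 => (RCLike.re z, RCLike.im z))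
    (fun z w h => ?_) (Cardinal.mk_prod_le_continuum Cardinal.mk_real.le Cardinal.mk_real.le)
  simp only [Prod.mk.injEq] at h
  exact RCLike.ext h.1 h.2

theorem Cardinal.mk_countable_sets_le_continuum {α : Type*} (hα : #α ≤ 𝔠) :
    #{t : Set α // t.Countable} ≤ 𝔠 := by
  have h := Cardinal.mk_bounded_set_le α ℵ₀
  simp only [Cardinal.le_aleph0_iff_set_countable] at h
  refine h.trans ?_
  rw [← Cardinal.continuum_power_aleph0]
  exact Cardinal.power_le_power_right (max_le hα Cardinal.aleph0_le_continuum)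

/-- A span of at most continuum many vectors has at most continuum many elements. -/
theorem Cardinal.mk_span_le_continuum {𝕜 : Type*} [RCLike 𝕜] {X : Type*} [AddCommGroup X]
    [Module 𝕜 X] {A : Set X} (hA : #A ≤ 𝔠) : #(Submodule.span 𝕜 A) ≤ 𝔠 := by
  have hL : #(List (𝕜 × A)) ≤ 𝔠 :=
    (Cardinal.mk_list_le_max _).trans (max_le Cardinal.aleph0_le_continuum
      (Cardinal.mk_prod_le_continuum (Cardinal.mk_rclike_le_continuum 𝕜) hA))
  have key : ∀ x ∈ Submodule.span 𝕜 A,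
      ∃ l : List (𝕜 × A), (l.map fun p => p.1 • (p.2 : X)).sum = x := by
    intro x hx
    induction hx using Submodule.span_induction with
    | mem x hx => exact ⟨[(1, ⟨x, hx⟩)], by simp⟩
    | zero => exact ⟨[], rfl⟩
    | add x y _ _ hx hy =>
      obtain ⟨l, rfl⟩ := hx
      obtain ⟨m, rfl⟩ := hy
      exact ⟨l ++ m, by simp⟩
    | smul a x _ hx =>
      obtain ⟨l, rfl⟩ := hx
      exact ⟨l.map fun p => (a * p.1, p.2), by
        simp [List.smul_sum, Function.comp_def, mul_smul]⟩
  choose l hl using key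
  refine Cardinal.mk_le_continuum_of_injective (f := fun x : Submodule.span 𝕜 A => l x x.2)
    (fun x y h => Subtype.ext ?_) hL
  rw [← hl x x.2, ← hl y y.2]
  exact congrArg (fun m : List (𝕜 × A) => (m.map fun p => p.1 • (p.2 : X)).sum) h

/-- At most `𝔠` functions arise by restricting the continuous functionals on `X` to a fixed subset
of cardinality at most `𝔠`. The dual of such a space may well be larger than `𝔠`. -/
def HasFewRestrictions (𝕜 : Type*) [RCLike 𝕜] (X : Type*) [NormedAddCommGroup X]
    [NormedSpace 𝕜 X] : Prop :=
  ∀ A : Set X, #A ≤ 𝔠 → #(Set.range fun (f : X →L[𝕜] 𝕜) (a : A) => f a) ≤ 𝔠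

/-- A functional on `c₀(Γ)`, restricted to `A`, is coded by the countable part of its graph on
those unit vectors that lie in the support of some element of `A`. -/
theorem hasFewRestrictions_c0 (𝕜 : Type*) [RCLike 𝕜] (Γ : Type*) [TopologicalSpace Γ]
    [DiscreteTopology Γ] : HasFewRestrictions 𝕜 C₀(Γ, 𝕜) := by
  intro A hA
  -- the coordinates that `A` sees: at most `𝔠` many, since supports are countable
  let S : Set Γ := {γ | ∃ φ ∈ A, φ γ ≠ 0}
  have hS : #S ≤ 𝔠 := by
    have : ∀ φ : A, ∃ e : ℕ → Option Γ, Set.range e ⊇ some '' Function.support (φ : C₀(Γ, 𝕜)) :=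
      fun φ => by
        have hc := (φ : C₀(Γ, 𝕜)).countable_support.image some
        obtain ⟨e, he⟩ := (hc.insert none).exists_eq_range (Set.insert_nonempty _ _)
        exact ⟨e, he ▸ Set.subset_insert _ _⟩
    choose e he using this
    have hpre : ∀ s : S, ∃ p : A × ℕ, e p.1 p.2 = some (s : Γ) := by
      rintro ⟨γ, φ, hφ, hne⟩
      obtain ⟨n, hn⟩ := he ⟨φ, hφ⟩ ⟨γ, hne, rfl⟩
      exact ⟨(⟨φ, hφ⟩, n), hn⟩
    choose p hp using hpre
    refine Cardinal.mk_le_continuum_of_injective (f := p) (fun s t h => Subtype.ext ?_)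
      (Cardinal.mk_prod_le_continuum hA (by simpa using Cardinal.aleph0_le_continuum))
    have h1 := hp s
    rw [h, hp t] at h1
    exact (Option.some_injective _ h1).symm
  let code : (C₀(Γ, 𝕜) →L[𝕜] 𝕜) → {t : Set (S × 𝕜) // t.Countable} := fun f =>
    ⟨{p | p.2 ≠ 0 ∧ f (c0Single (p.1 : Γ)) = p.2}, by
      refine Set.MapsTo.countable_of_injOn (f := fun p : S × 𝕜 => (p.1 : Γ))
        (t := Function.support fun γ => f (c0Single γ)) ?_ ?_ (countable_support_apply_c0Single f)
      · rintro p ⟨hp0, hp⟩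
        simpa [hp] using hp0
      · rintro ⟨s, a⟩ ⟨_, hp⟩ ⟨t, b⟩ ⟨_, hq⟩ h
        have hst : s = t := Subtype.ext h
        subst hst
        simp only at hp hq
        rw [← hp, ← hq]⟩
  have hcode : ∀ f g, code f = code g → ∀ φ ∈ A, f φ = g φ := by
    intro f g h φ hφ
    refine apply_eq_of_eq_c0Single fun γ hγ => ?_
    have hset := Subtype.ext_iff.1 h
    have hγS : γ ∈ S := ⟨φ, hφ, hγ⟩
    by_cases hf : f (c0Single γ) = 0
    · by_contra hg
      have : ((⟨γ, hγS⟩, g (c0Single γ)) : S × 𝕜) ∈ (code g).1 :=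
        ⟨fun h0 => hg (hf.trans h0.symm), rfl⟩
      rw [← hset] at this
      exact hg this.2
    · have : ((⟨γ, hγS⟩, f (c0Single γ)) : S × 𝕜) ∈ (code f).1 := ⟨hf, rfl⟩
      rw [hset] at this
      exact this.2.symm
  refine Cardinal.mk_le_continuum_of_injective (f := fun r : Set.range _ => code r.2.choose)
    (fun r s h => Subtype.ext ?_) (Cardinal.mk_countable_sets_le_continuum
      (Cardinal.mk_prod_le_continuum hS (Cardinal.mk_rclike_le_continuum 𝕜)))
  rw [← r.2.choose_spec, ← s.2.choose_spec]
  funext a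
  exact hcode _ _ h a a.2

/-- A functional `d` on a subspace `V` that is dominated by `‖q ·‖` is induced by a functional on
the codomain of `q`. -/
theorem exists_comp_eq_of_norm_le {𝕜 : Type*} [RCLike 𝕜] {V : Type*} [AddCommGroup V] [Module 𝕜 V]
    {Z : Type*} [NormedAddCommGroup Z] [NormedSpace 𝕜 Z] (q : V →ₗ[𝕜] Z) (d : V →ₗ[𝕜] 𝕜) (C : ℝ)
    (h : ∀ v, ‖d v‖ ≤ C * ‖q v‖) : ∃ g : Z →L[𝕜] 𝕜, ∀ v, g (q v) = d v := by
  obtain ⟨s, hs⟩ := q.rangeRestrict.exists_rightInverse_of_surjective q.range_rangeRestrict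
  have hs' : ∀ z, q (s z) = z := fun z => congrArg Subtype.val (LinearMap.congr_fun hs z)
  let d' : q.range →L[𝕜] 𝕜 := (d.comp s).mkContinuous C fun z => by
    simpa [hs' z] using h (s z)
  obtain ⟨g, hg, -⟩ := exists_extension_norm_eq q.range d'
  refine ⟨g, fun v => ?_⟩
  have h1 : g (q v) = d (s ⟨q v, v, rfl⟩) := hg ⟨q v, v, rfl⟩
  have h2 := h (s ⟨q v, v, rfl⟩ - v)
  rw [map_sub, map_sub, hs', sub_self, norm_zero, mul_zero] at h2
  rw [h1]
  exact sub_eq_zero.1 (norm_le_zero_iff.1 h2)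

/-- The three-space property of `HasFewRestrictions`. -/
theorem IsShortExactSeq.hasFewRestrictions {𝕜 : Type uk} [RCLike 𝕜]
    {Y : Type uy} [NormedAddCommGroup Y] [NormedSpace 𝕜 Y]
    {X : Type ux} [NormedAddCommGroup X] [NormedSpace 𝕜 X] [CompleteSpace X]
    {Z : Type uz} [NormedAddCommGroup Z] [NormedSpace 𝕜 Z] [CompleteSpace Z]
    {i : Y →L[𝕜] X} {q : X →L[𝕜] Z} (h : IsShortExactSeq i q)
    (hY : HasFewRestrictions 𝕜 Y) (hZ : HasFewRestrictions 𝕜 Z) : HasFewRestrictions 𝕜 X := by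
  intro A hA
  obtain ⟨C, hC, hs⟩ := q.exists_preimage_norm_le h.surjective
  choose s hqs hsn using hs
  -- `V` contains `A` and, for each of its elements `v`, a controlled lift of `q v`
  let V₀ := Submodule.span 𝕜 A
  let V := Submodule.span 𝕜 (A ∪ (fun v => s (q v)) '' (V₀ : Set X))
  have hV₀ : #V₀ ≤ 𝔠 := Cardinal.mk_span_le_continuum hA
  have hV : #V ≤ 𝔠 := by
    refine Cardinal.mk_span_le_continuum ((Cardinal.mk_union_le _ _).trans ?_)
    rw [← Cardinal.continuum_add_self]
    exact add_le_add hA (Cardinal.mk_image_le.trans hV₀)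
  have hV₀V : V₀ ≤ V := Submodule.span_mono Set.subset_union_left
  have hmap : ∀ v ∈ V, ∃ w ∈ V₀, q w = q v := by
    intro v hv
    have hle : V ≤ (V₀.map q.toLinearMap).comap q.toLinearMap := by
      refine Submodule.span_le.2 ?_
      rintro x (hx | ⟨w, hw, rfl⟩)
      · exact ⟨x, Submodule.subset_span hx, rfl⟩
      · exact ⟨w, hw, (hqs (q w)).symm⟩
    exact hle hv
  have hlift : ∀ v ∈ V, s (q v) ∈ V := by
    intro v hv
    obtain ⟨w, hw, hwv⟩ := hmap v hv
    rw [← hwv]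
    exact Submodule.subset_span (Or.inr ⟨w, hw, rfl⟩)
  have hVY : #(i ⁻¹' (V : Set X)) ≤ 𝔠 :=
    Cardinal.mk_le_continuum_of_injective
      (f := fun y : i ⁻¹' (V : Set X) => (⟨i y, y.2⟩ : V))
      (fun y z hyz => Subtype.ext (h.injective (congrArg Subtype.val hyz))) hV
  have hVZ : #(q '' (V : Set X)) ≤ 𝔠 :=
    Cardinal.mk_le_continuum_of_surjective
      (f := fun v : V => (⟨q v, v, v.2, rfl⟩ : q '' (V : Set X)))
      (by rintro ⟨_, v, hv, rfl⟩; exact ⟨⟨v, hv⟩, rfl⟩) hV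
  have hR1 := hY _ hVY
  have hR2 := hZ _ hVZ
  -- functionals with the same trace on `i Y ∩ V` differ on `V` by a functional coming from `Z`
  have hdiff : ∀ f g : X →L[𝕜] 𝕜, (∀ y, i y ∈ V → f (i y) = g (i y)) →
      ∃ k : Z →L[𝕜] 𝕜, ∀ v ∈ V, f v = g v + k (q v) := by
    intro f g hfg
    obtain ⟨k, hk⟩ := exists_comp_eq_of_norm_le (q.toLinearMap.comp V.subtype)
      ((f - g).toLinearMap.comp V.subtype) (‖f - g‖ * C) fun v => by
        have hker : q (v - s (q v)) = 0 := by rw [map_sub, hqs, sub_self]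
        obtain ⟨y, hy⟩ := (h.exact _).1 hker
        have hyV : i y ∈ V := hy ▸ V.sub_mem v.2 (hlift v v.2)
        have h0 : (f - g) (v - s (q v)) = 0 := by
          rw [← hy]
          simpa [sub_eq_zero] using hfg y hyV
        rw [map_sub, sub_eq_zero] at h0
        change ‖(f - g) (v : X)‖ ≤ _ * ‖q (v : X)‖
        rw [h0, mul_assoc]
        exact (f - g).le_opNorm_of_le (hsn (q v))
    refine ⟨k, fun v hv => ?_⟩
    have := hk ⟨v, hv⟩
    simp only [LinearMap.comp_apply, Submodule.subtype_apply, ContinuousLinearMap.coe_coe,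
      sub_apply] at this
    rw [this, add_sub_cancel]
  -- the traces on `i Y ∩ V` that come from `X`, among all traces of functionals on `Y`
  let R := Set.range fun (f : X →L[𝕜] 𝕜) (y : i ⁻¹' (V : Set X)) => f (i y)
  have hR : #R ≤ 𝔠 := by
    refine (Cardinal.mk_le_mk_of_subset ?_).trans hR1
    rintro _ ⟨f, rfl⟩
    exact ⟨f.comp i, rfl⟩
  let ρ : R → X →L[𝕜] 𝕜 := fun r => r.2.choose
  have hρ : ∀ r : R, ∀ y : i ⁻¹' (V : Set X), ρ r (i y) = (r : _ → 𝕜) y := fun r y =>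
    congrFun r.2.choose_spec y
  have hAV : A ⊆ V := fun a ha => hV₀V (Submodule.subset_span ha)
  refine (Cardinal.mk_le_mk_of_subset (t := Set.range
    fun (p : R × Set.range fun (k : Z →L[𝕜] 𝕜) (z : q '' (V : Set X)) => k z) (a : A) =>
      ρ p.1 a + (p.2 : q '' (V : Set X) → 𝕜) ⟨q a, a, hAV a.2, rfl⟩) ?_).trans
    (Cardinal.mk_le_continuum_of_surjective Set.rangeFactorization_surjective
      (Cardinal.mk_prod_le_continuum hR hR2))
  rintro _ ⟨f, rfl⟩
  let r : R := ⟨_, f, rfl⟩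
  obtain ⟨k, hk⟩ := hdiff f (ρ r) fun y hy => (hρ r ⟨y, hy⟩).symm
  exact ⟨(r, ⟨_, k, rfl⟩), funext fun a => (hk a (hAV a.2)).symm⟩

end Counting

/-! ### The quotient of bounded sequences by null sequences -/

open scoped BoundedContinuousFunction

section Quotient

variable (𝕜 : Type*) [RCLike 𝕜]

/-- The inclusion of `c₀` into the space `ℕ →ᵇ 𝕜` of bounded sequences. -/
noncomputable def c0Inclusion : C₀(ℕ, 𝕜) →ₗᵢ[𝕜] (ℕ →ᵇ 𝕜) where
  toFun := ZeroAtInftyContinuousMap.toBCF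
  map_add' _ _ := rfl
  map_smul' _ _ := rfl
  norm_map' _ := ZeroAtInftyContinuousMap.norm_toBCF_eq_norm

/-- The null sequences, as a subspace of the bounded sequences. -/
noncomputable def nullSequences : Submodule 𝕜 (ℕ →ᵇ 𝕜) := (c0Inclusion 𝕜).toLinearMap.range

instance isClosed_nullSequences : IsClosed (nullSequences 𝕜 : Set (ℕ →ᵇ 𝕜)) :=
  ZeroAtInftyContinuousMap.isClosed_range_toBCF

variable {𝕜}

theorem norm_mkQL_le_of_finite (y : ℕ →ᵇ 𝕜) {M : ℝ} (hM : 0 ≤ M)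
    (h : {n | M < ‖y n‖}.Finite) : ‖(nullSequences 𝕜).mkQL y‖ ≤ M := by
  classical
  -- remove the finitely many large terms
  let z : C₀(ℕ, 𝕜) := ZeroAtInftyContinuousMap.ofFinite (fun n => if M < ‖y n‖ then y n else 0)
    fun ε hε => h.subset fun n hn => by
      by_contra hlt
      have hlt' : ¬ M < ‖y n‖ := hlt
      simp [hlt'] at hn
      linarith
  have hz : (nullSequences 𝕜).mkQL (c0Inclusion 𝕜 z) = 0 :=
    (Submodule.Quotient.mk_eq_zero _).2 ⟨z, rfl⟩
  have : (nullSequences 𝕜).mkQL y = (nullSequences 𝕜).mkQL (y - c0Inclusion 𝕜 z) := by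
    rw [map_sub, hz, sub_zero]
  rw [this]
  refine (Submodule.Quotient.norm_mk_le _ _).trans
    ((BoundedContinuousFunction.norm_le hM).2 fun n => ?_)
  change ‖y n - (if M < ‖y n‖ then y n else 0)‖ ≤ M
  split_ifs with hn
  · simpa using hM
  · simpa using hn

theorem le_norm_mkQL_of_infinite (y : ℕ →ᵇ 𝕜) {m : ℝ} (h : {n | m ≤ ‖y n‖}.Infinite) :
    m ≤ ‖(nullSequences 𝕜).mkQL y‖ := by
  refine le_of_forall_pos_le_add fun ε hε => ?_
  obtain ⟨w, hw, hwn⟩ := Submodule.Quotient.norm_mk_lt ((nullSequences 𝕜).mkQL y) (half_pos hε)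
  obtain ⟨z, hz⟩ := (Submodule.Quotient.eq _).1 hw
  obtain ⟨n, hn, hzn⟩ := (h.sdiff (z.finite_le_norm (half_pos hε))).nonempty
  have hzn' : ‖z n‖ < ε / 2 := not_le.1 hzn
  have hval : z n = w n - y n := DFunLike.congr_fun hz n
  have hyn : y n = w n - z n := by rw [hval]; ring
  have hn' : m ≤ ‖y n‖ := hn
  calc m ≤ ‖w n - z n‖ := by rwa [← hyn]
    _ ≤ ‖w n‖ + ‖z n‖ := norm_sub_le _ _
    _ ≤ ‖(nullSequences 𝕜).mkQL y‖ + ε / 2 + ε / 2 :=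
        add_le_add ((w.norm_coe_le_norm n).trans hwn.le) hzn'.le
    _ = _ := by ring

/-- The code of the `n`-th node of the branch `σ` of the binary tree. -/
def branchNode (σ : ℕ → Bool) (n : ℕ) : ℕ :=
  Encodable.encode (List.ofFn fun i : Fin n => σ i)

theorem branchNode_eq {σ τ : ℕ → Bool} {m n : ℕ} (h : branchNode σ m = branchNode τ n) :
    m = n ∧ ∀ k < m, σ k = τ k := by
  have h1 := Encodable.encode_injective h
  have hmn : m = n := by simpa using congrArg List.length h1
  subst hmn
  exact ⟨rfl, fun k hk => congrFun (List.ofFn_injective h1) ⟨k, hk⟩⟩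

/-- The branches of the binary tree are almost disjoint. -/
theorem finite_branch_inter {σ τ : ℕ → Bool} (h : σ ≠ τ) :
    (Set.range (branchNode σ) ∩ Set.range (branchNode τ)).Finite := by
  obtain ⟨k, hk⟩ := Function.ne_iff.1 h
  refine ((Set.finite_Iic k).image (branchNode σ)).subset ?_
  rintro _ ⟨⟨m, rfl⟩, ⟨n, hn⟩⟩
  refine ⟨m, not_lt.1 fun hkm => hk ((branchNode_eq hn.symm).2 k hkm), rfl⟩

theorem infinite_branch (σ : ℕ → Bool) : (Set.range (branchNode σ)).Infinite :=
  Set.infinite_range_of_injective fun _ _ h => (branchNode_eq h).1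

variable (𝕜) in
open Classical in
/-- The indicator sequence of the branch `σ`. -/
noncomputable def branchIndicator (σ : ℕ → Bool) : ℕ →ᵇ 𝕜 :=
  BoundedContinuousFunction.ofNormedAddCommGroupDiscrete
    (fun s => if s ∈ Set.range (branchNode σ) then 1 else 0) 1 fun s => by
      split_ifs <;> simp

open Classical in
theorem branchIndicator_apply (σ : ℕ → Bool) (s : ℕ) :
    branchIndicator 𝕜 σ s = if s ∈ Set.range (branchNode σ) then 1 else 0 := rfl

theorem finite_branch_overlaps (F : Finset (ℕ → Bool)) :
    {s | ∃ σ ∈ F, ∃ τ ∈ F, σ ≠ τ ∧ s ∈ Set.range (branchNode σ) ∧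
      s ∈ Set.range (branchNode τ)}.Finite := by
  have : (⋃ σ ∈ F, ⋃ τ ∈ F, {s | σ ≠ τ ∧ s ∈ Set.range (branchNode σ) ∧
      s ∈ Set.range (branchNode τ)}).Finite := by
    refine F.finite_toSet.biUnion fun σ _ => F.finite_toSet.biUnion fun τ _ => ?_
    by_cases hne : σ = τ
    · simp [hne]
    · exact (finite_branch_inter hne).subset fun s hs => hs.2
  refine this.subset ?_
  rintro s ⟨σ, hσ, τ, hτ, hs⟩
  simp only [Set.mem_iUnion]
  exact ⟨σ, hσ, τ, hτ, hs⟩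

theorem sum_smul_branchIndicator_apply (F : Finset (ℕ → Bool)) (a : (ℕ → Bool) → 𝕜) (s : ℕ) :
    (∑ τ ∈ F, a τ • branchIndicator 𝕜 τ) s = ∑ τ ∈ F, a τ * branchIndicator 𝕜 τ s := by
  simp [BoundedContinuousFunction.coe_sum]

theorem sum_smul_branchIndicator_eq {F : Finset (ℕ → Bool)} (a : (ℕ → Bool) → 𝕜) {s : ℕ}
    (hs : ¬ ∃ σ ∈ F, ∃ τ ∈ F, σ ≠ τ ∧ s ∈ Set.range (branchNode σ) ∧
      s ∈ Set.range (branchNode τ)) {σ : ℕ → Bool} (hσ : σ ∈ F)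
    (hsσ : s ∈ Set.range (branchNode σ)) :
    (∑ τ ∈ F, a τ • branchIndicator 𝕜 τ) s = a σ := by
  rw [sum_smul_branchIndicator_apply, Finset.sum_eq_single_of_mem σ hσ fun τ hτ hne => ?_]
  · rw [branchIndicator_apply, if_pos hsσ, mul_one]
  · rw [branchIndicator_apply, if_neg fun h => hs ⟨σ, hσ, τ, hτ, hne.symm, hsσ, h⟩, mul_zero]

theorem norm_sum_branch_le (F : Finset (ℕ → Bool)) (a : (ℕ → Bool) → 𝕜) {M : ℝ} (hM : 0 ≤ M)
    (h : ∀ σ ∈ F, ‖a σ‖ ≤ M) :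
    ‖∑ σ ∈ F, a σ • (nullSequences 𝕜).mkQL (branchIndicator 𝕜 σ)‖ ≤ M := by
  simp only [← map_smul, ← map_sum]
  refine norm_mkQL_le_of_finite _ hM ((finite_branch_overlaps F).subset fun s hs => ?_)
  by_contra hno
  have hs' : M < ‖(∑ σ ∈ F, a σ • branchIndicator 𝕜 σ) s‖ := hs
  refine absurd hs' (not_lt.2 ?_)
  by_cases hex : ∃ σ ∈ F, s ∈ Set.range (branchNode σ)
  · obtain ⟨σ, hσ, hsσ⟩ := hex
    rw [sum_smul_branchIndicator_eq a hno hσ hsσ]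
    exact h σ hσ
  · rw [sum_smul_branchIndicator_apply, Finset.sum_eq_zero fun τ hτ => ?_]
    · simpa using hM
    · rw [branchIndicator_apply, if_neg fun h => hex ⟨τ, hτ, h⟩, mul_zero]

theorem le_norm_sum_branch {F : Finset (ℕ → Bool)} (a : (ℕ → Bool) → 𝕜) {σ : ℕ → Bool}
    (hσ : σ ∈ F) :
    ‖a σ‖ ≤ ‖∑ σ ∈ F, a σ • (nullSequences 𝕜).mkQL (branchIndicator 𝕜 σ)‖ := by
  simp only [← map_smul, ← map_sum]
  refine le_norm_mkQL_of_infinite _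
    (((infinite_branch σ).sdiff (finite_branch_overlaps F)).mono fun s hs => ?_)
  exact (congrArg norm (sum_smul_branchIndicator_eq a hs.2 hσ hs.1)).ge

end Quotient

/-! ### Operators to the quotient and the counting argument -/

section Operators

variable {𝕜 : Type*} [RCLike 𝕜]

/-- A bounded family of functionals tending to `0` pointwise and vectors `u j` whose finite linear
combinations are bounded by their largest coefficient define an operator `x ↦ ∑ f j x • u j`. -/
theorem exists_hasSum_smul {X : Type*} [NormedAddCommGroup X] [NormedSpace 𝕜 X]
    {Q : Type*} [NormedAddCommGroup Q] [NormedSpace 𝕜 Q] [CompleteSpace Q] {J : Type*}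
    (f : J → X →L[𝕜] 𝕜) {C : ℝ} (hC : ∀ j, ‖f j‖ ≤ C)
    (h0 : ∀ x, ∀ ε > 0, {j | ε ≤ ‖f j x‖}.Finite) (u : J → Q)
    (hu : ∀ (F : Finset J) (a : J → 𝕜) (M : ℝ), 0 ≤ M → (∀ j ∈ F, ‖a j‖ ≤ M) →
      ‖∑ j ∈ F, a j • u j‖ ≤ M) :
    ∃ T : X →L[𝕜] Q, ∀ x, HasSum (fun j => f j x • u j) (T x) := by
  have hsum : ∀ x, Summable fun j => f j x • u j := fun x => by
    rw [summable_iff_vanishing_norm]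
    refine fun ε hε => ⟨(h0 x (ε / 2) (half_pos hε)).toFinset, fun t ht => ?_⟩
    refine (hu t (fun j => f j x) (ε / 2) (half_pos hε).le fun j hj => ?_).trans_lt
      (half_lt_self hε)
    have := Finset.disjoint_left.1 ht hj
    simp only [Set.Finite.mem_toFinset, Set.mem_ofPred_eq, not_le] at this
    exact this.le
  let T : X →ₗ[𝕜] Q :=
    { toFun := fun x => ∑' j, f j x • u j
      map_add' := fun x y => by
        simp only [map_add, add_smul]
        exact (hsum x).tsum_add (hsum y)
      map_smul' := fun c x => by
        simp only [map_smul, smul_assoc, RingHom.id_apply]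
        exact (hsum x).tsum_const_smul c }
  refine ⟨T.mkContinuous (max C 0) fun x => ?_, fun x => (hsum x).hasSum⟩
  refine le_of_tendsto (hsum x).hasSum.norm (.of_forall fun F => ?_)
  exact hu F _ _ (by positivity) fun j _ =>
    (f j).le_of_opNorm_le ((hC j).trans (le_max_left _ _)) x

/-- An operator vanishing on the kernel of a surjection `q` between Banach spaces factors
through `q`. -/
theorem exists_comp_eq_of_ker_le {E : Type*} [NormedAddCommGroup E] [NormedSpace 𝕜 E]
    [CompleteSpace E] {X : Type*} [NormedAddCommGroup X] [NormedSpace 𝕜 X] [CompleteSpace X]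
    {G : Type*} [NormedAddCommGroup G] [NormedSpace 𝕜 G] (q : E →L[𝕜] X)
    (hq : Function.Surjective q) (R : E →L[𝕜] G) (hR : ∀ e, q e = 0 → R e = 0) :
    ∃ L : X →L[𝕜] G, ∀ e, L (q e) = R e := by
  obtain ⟨C, -, hs⟩ := q.exists_preimage_norm_le hq
  choose s hqs hsn using hs
  have hR' : ∀ e e', q e = q e' → R e = R e' := fun e e' h => by
    have := hR (e - e') (by rw [map_sub, h, sub_self])
    rwa [map_sub, sub_eq_zero] at this
  let L : X →ₗ[𝕜] G :=
    { toFun := fun x => R (s x)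
      map_add' := fun x y => by
        rw [← map_add]
        exact hR' _ _ (by simp [hqs])
      map_smul' := fun c x => by
        rw [RingHom.id_apply, ← map_smul]
        exact hR' _ _ (by simp [hqs]) }
  refine ⟨L.mkContinuous (‖R‖ * C) fun x => ?_, fun e => hR' _ _ (hqs _)⟩
  rw [mul_assoc]
  exact R.le_opNorm_of_le (hsn x)

/-- If `Ext(X, c₀) = 0`, every operator from `X` to `ℓ∞ / c₀` lifts to `ℓ∞`, because the pullback
of `0 ⟶ c₀ ⟶ ℓ∞ ⟶ ℓ∞ / c₀ ⟶ 0` along the operator splits. -/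
theorem ExtEqZero.exists_lift {𝕜 : Type uk} [RCLike 𝕜] {X : Type ux} [NormedAddCommGroup X]
    [NormedSpace 𝕜 X] [CompleteSpace X] (h : ExtEqZero 𝕜 X C₀(ℕ, 𝕜))
    (T : X →L[𝕜] (ℕ →ᵇ 𝕜) ⧸ nullSequences 𝕜) :
    ∃ L : X →L[𝕜] (ℕ →ᵇ 𝕜), ∀ x, (nullSequences 𝕜).mkQL (L x) = T x := by
  let D : X × (ℕ →ᵇ 𝕜) →L[𝕜] (ℕ →ᵇ 𝕜) ⧸ nullSequences 𝕜 :=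
    T.comp (ContinuousLinearMap.fst 𝕜 X (ℕ →ᵇ 𝕜)) -
      (nullSequences 𝕜).mkQL.comp (ContinuousLinearMap.snd 𝕜 X (ℕ →ᵇ 𝕜))
  let E : Submodule 𝕜 (X × (ℕ →ᵇ 𝕜)) := D.toLinearMap.ker
  have hE : ∀ p : X × (ℕ →ᵇ 𝕜), p ∈ E ↔ T p.1 = (nullSequences 𝕜).mkQL p.2 := fun p => by
    change T p.1 - (nullSequences 𝕜).mkQL p.2 = 0 ↔ _
    rw [sub_eq_zero]
  have hEc : IsClosed (E : Set (X × (ℕ →ᵇ 𝕜))) := D.isClosed_ker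
  have : CompleteSpace E := hEc.completeSpace_coe
  have hnull : ∀ c : C₀(ℕ, 𝕜), (nullSequences 𝕜).mkQL (c0Inclusion 𝕜 c) = 0 := fun c =>
    (Submodule.Quotient.mk_eq_zero _).2 ⟨c, rfl⟩
  let i : C₀(ℕ, 𝕜) →L[𝕜] E :=
    ((ContinuousLinearMap.inr 𝕜 X (ℕ →ᵇ 𝕜)).comp
      (c0Inclusion 𝕜).toContinuousLinearMap).codRestrict E fun c => by
        rw [hE]
        change T 0 = (nullSequences 𝕜).mkQL (c0Inclusion 𝕜 c)
        rw [map_zero, hnull]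
  let q : E →L[𝕜] X := (ContinuousLinearMap.fst 𝕜 X (ℕ →ᵇ 𝕜)).comp E.subtypeL
  let p₂ : E →L[𝕜] (ℕ →ᵇ 𝕜) := (ContinuousLinearMap.snd 𝕜 X (ℕ →ᵇ 𝕜)).comp E.subtypeL
  have hseq : IsShortExactSeq i q := by
    refine ⟨fun c d hcd => (c0Inclusion 𝕜).injective (congrArg p₂ hcd), fun e => ?_, fun x => ?_⟩
    · constructor
      · intro he
        have h1 : T (q e) = (nullSequences 𝕜).mkQL (p₂ e) := (hE _).1 e.2
        rw [he, map_zero] at h1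
        obtain ⟨c, hc⟩ := (Submodule.Quotient.mk_eq_zero _).1 h1.symm
        exact ⟨c, Subtype.ext (Prod.ext he.symm hc)⟩
      · rintro ⟨c, rfl⟩
        rfl
    · obtain ⟨y, hy⟩ := Submodule.Quotient.mk_surjective _ (T x)
      exact ⟨⟨(x, y), (hE _).2 hy.symm⟩, rfl⟩
  obtain ⟨P, hP⟩ := h E i q hseq
  have hPnull : ∀ e, (nullSequences 𝕜).mkQL (p₂ (P e)) = 0 := fun e => by
    obtain ⟨c, hc⟩ := (P e).2
    rw [← hc]
    exact hnull c
  obtain ⟨L, hL⟩ := exists_comp_eq_of_ker_le q hseq.surjective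
    (p₂ - p₂.comp ((Submodule.subtypeL _).comp P)) fun e he => by
      have hr : e ∈ LinearMap.range (i : C₀(ℕ, 𝕜) →ₗ[𝕜] E) := (hseq.exact e).1 he
      have h1 : (P e : E) = e := congrArg Subtype.val (hP ⟨e, hr⟩)
      change p₂ e - p₂ (P e) = 0
      rw [h1, sub_self]
  refine ⟨L, fun x => ?_⟩
  obtain ⟨e, rfl⟩ := hseq.surjective x
  have h1 : T (q e) = (nullSequences 𝕜).mkQL (p₂ e) := (hE _).1 e.2
  rw [hL, h1]
  change (nullSequences 𝕜).mkQL (p₂ e - p₂ (P e)) = _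
  rw [map_sub, hPnull, sub_zero]

open Cardinal

/-- `X` carries a bounded family of nonzero functionals, indexed by the branches of the binary
tree, that tends to `0` pointwise; equivalently, there is an operator from `X` to `c₀(2^ℕ)` none of
whose coordinates vanishes identically. -/
def HasNullFamily (𝕜 : Type*) [RCLike 𝕜] (X : Type*) [NormedAddCommGroup X]
    [NormedSpace 𝕜 X] : Prop :=
  ∃ f : (ℕ → Bool) → X →L[𝕜] 𝕜, (∃ C, ∀ σ, ‖f σ‖ ≤ C) ∧
    (∀ x, ∀ ε > 0, {σ | ε ≤ ‖f σ x‖}.Finite) ∧ ∀ σ, f σ ≠ 0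

/-- Each set `S` of branches yields an operator `x ↦ ∑_{σ ∈ S} f σ x • [1_σ]` to `ℓ∞ / c₀`. Were
`Ext(X, c₀) = 0`, these `2 ^ 𝔠` operators would lift to operators into `ℓ∞` that are still
distinguished by their values on `𝔠` vectors, whereas a sequence of functionals has at most
`𝔠 ^ ℵ₀ = 𝔠` restrictions to that set. -/
theorem not_extEqZero_of_hasNullFamily {𝕜 : Type uk} [RCLike 𝕜] {X : Type ux}
    [NormedAddCommGroup X] [NormedSpace 𝕜 X] [CompleteSpace X] (hfew : HasFewRestrictions 𝕜 X)
    (hnull : HasNullFamily 𝕜 X) : ¬ ExtEqZero 𝕜 X C₀(ℕ, 𝕜) := by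
  classical
  intro hext
  obtain ⟨f, ⟨C, hC⟩, h0, hne⟩ := hnull
  have hx : ∀ σ, ∃ x, f σ x ≠ 0 := fun σ => by
    by_contra hcon
    push Not at hcon
    exact hne σ (ContinuousLinearMap.ext hcon)
  choose x hx using hx
  have hT : ∀ S : Set (ℕ → Bool), ∃ L : X →L[𝕜] (ℕ →ᵇ 𝕜), ∀ v,
      HasSum (fun τ => (if τ ∈ S then f τ v else 0) •
        (nullSequences 𝕜).mkQL (branchIndicator 𝕜 τ)) ((nullSequences 𝕜).mkQL (L v)) := by
    intro S
    have happ : ∀ τ v, (if τ ∈ S then f τ else 0) v = if τ ∈ S then f τ v else 0 := fun τ v => by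
      split_ifs <;> rfl
    obtain ⟨T, hT⟩ := exists_hasSum_smul (fun τ => if τ ∈ S then f τ else 0) (C := C)
      (fun τ => by
        split_ifs
        · exact hC τ
        · simpa using (norm_nonneg _).trans (hC τ))
      (fun v ε hε => (h0 v ε hε).subset fun τ hτ => by
        have hτ' : ε ≤ ‖(if τ ∈ S then f τ else 0) v‖ := hτ
        rw [happ] at hτ'
        split_ifs at hτ' with hS
        · exact hτ'
        · simp only [norm_zero] at hτ'
          exact absurd hτ' (not_le.2 hε))
      (fun τ => (nullSequences 𝕜).mkQL (branchIndicator 𝕜 τ))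
      (fun F a M hM ha => norm_sum_branch_le F a hM ha)
    obtain ⟨L, hL⟩ := hext.exists_lift T
    refine ⟨L, fun v => ?_⟩
    rw [hL]
    simpa only [happ] using hT v
  choose L hL using hT
  have hbranch : #(ℕ → Bool) = 𝔠 := by simp
  have hA : #(Set.range x) ≤ 𝔠 :=
    mk_le_continuum_of_surjective Set.rangeFactorization_surjective hbranch.le
  let Φ : Set (ℕ → Bool) → ℕ → Set.range fun (g : X →L[𝕜] 𝕜) (a : Set.range x) => g a :=
    fun S n => ⟨_, (BoundedContinuousFunction.evalCLM 𝕜 n).comp (L S), rfl⟩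
  have hΦ : Function.Injective Φ := by
    have key : ∀ S S', Φ S = Φ S' → ∀ σ ∈ S, σ ∈ S' := by
      intro S S' h σ hσ
      by_contra hσ'
      have hLeq : L S (x σ) = L S' (x σ) := by
        ext n
        exact congrFun (Subtype.ext_iff.1 (congrFun h n)) ⟨x σ, σ, rfl⟩
      have hdiff := (hL S (x σ)).sub (hL S' (x σ))
      simp only [hLeq, sub_self, ← sub_smul] at hdiff
      have hlim := hdiff.norm
      rw [norm_zero] at hlim
      refine absurd (ge_of_tendsto hlim ?_) (not_le.2 (norm_pos_iff.2 (hx σ)))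
      filter_upwards [Filter.eventually_ge_atTop {σ}] with F hF
      refine le_trans ?_ (le_norm_sum_branch _ (Finset.singleton_subset_iff.1 hF))
      simp [hσ, hσ']
    exact fun S S' h => Set.Subset.antisymm (key S S' h) (key S' S h.symm)
  have hcard := mk_le_continuum_of_injective hΦ (mk_nat_arrow_le_continuum (hfew _ hA))
  rw [Cardinal.mk_set, hbranch] at hcard
  exact absurd hcard (not_le.2 (Cardinal.cantor _))

end Operators

/-! ### Null families on twisted sums -/

section NullFamily

open Cardinal

variable {𝕜 : Type uk} [RCLike 𝕜]

theorem HasNullFamily.of_surjective {X : Type ux} [NormedAddCommGroup X] [NormedSpace 𝕜 X]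
    {Z : Type uz} [NormedAddCommGroup Z] [NormedSpace 𝕜 Z] (q : X →L[𝕜] Z)
    (hq : Function.Surjective q) (h : HasNullFamily 𝕜 Z) : HasNullFamily 𝕜 X := by
  obtain ⟨f, ⟨C, hC⟩, h0, hne⟩ := h
  refine ⟨fun σ => (f σ).comp q, ⟨C * ‖q‖, fun σ => ?_⟩, fun x => h0 (q x), fun σ hσ => ?_⟩
  · exact ((f σ).opNorm_comp_le q).trans
      (mul_le_mul_of_nonneg_right (hC σ) (norm_nonneg _))
  · refine hne σ (ContinuousLinearMap.ext fun z => ?_)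
    obtain ⟨x, rfl⟩ := hq z
    exact DFunLike.congr_fun hσ x

/-- Under the continuum hypothesis the uncountably many nonzero coordinates of an operator to
`c₀(Γ)` can be indexed by the branches of the binary tree. -/
theorem hasNullFamily_of_not_countable (CH : Cardinal.aleph.{0} 1 = Cardinal.continuum.{0})
    {X : Type ux} [NormedAddCommGroup X] [NormedSpace 𝕜 X] {Γ : Type uy} [TopologicalSpace Γ]
    [DiscreteTopology Γ] (π : X →L[𝕜] C₀(Γ, 𝕜)) (h : ¬ {γ | ∃ x, π x γ ≠ 0}.Countable) :
    HasNullFamily 𝕜 X := by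
  have hcard : Cardinal.lift.{uy} #(ℕ → Bool) ≤ Cardinal.lift.{0} #{γ | ∃ x, π x γ ≠ 0} := by
    have h1 : #(ℕ → Bool) = ℵ₁ := by simp [CH]
    have h2 : ℵ₁ ≤ #{γ | ∃ x, π x γ ≠ 0} := by
      rw [Cardinal.aleph_one_le_iff, ← not_le, Cardinal.le_aleph0_iff_set_countable]
      exact h
    rw [h1]
    simpa using h2
  obtain ⟨j⟩ := Cardinal.lift_mk_le'.1 hcard
  let coord : Γ → X →L[𝕜] 𝕜 := fun γ =>
    LinearMap.mkContinuous
      { toFun := fun x => π x γ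
        map_add' := fun x y => by simp
        map_smul' := fun c x => by simp } ‖π‖ fun x =>
      (ZeroAtInftyContinuousMap.norm_apply_le (π x) γ).trans (π.le_opNorm x)
  refine ⟨fun σ => coord (j σ), ⟨‖π‖, fun σ => ?_⟩, fun x ε hε => ?_, fun σ hσ => ?_⟩
  · exact LinearMap.mkContinuous_norm_le _ (norm_nonneg π) _
  · exact ((π x).finite_le_norm hε).preimage (f := fun σ => (j σ : Γ))
      (fun σ _ τ _ hστ => j.injective (Subtype.ext hστ))
  · obtain ⟨x, hx⟩ := (j σ).2
    exact hx (DFunLike.congr_fun hσ x)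

/-- A surjection onto a separable Banach space remains surjective on some closed separable
subspace. -/
theorem exists_isSeparable_map_eq_top {X : Type ux} [NormedAddCommGroup X] [NormedSpace 𝕜 X]
    [CompleteSpace X] {Z : Type uz} [NormedAddCommGroup Z] [NormedSpace 𝕜 Z] [CompleteSpace Z]
    [TopologicalSpace.SeparableSpace Z] (q : X →L[𝕜] Z) (hq : Function.Surjective q) :
    ∃ W : Submodule 𝕜 X, IsClosed (W : Set X) ∧ TopologicalSpace.IsSeparable (W : Set X) ∧
      ∀ z, ∃ w ∈ W, q w = z := by
  obtain ⟨C, hC, hs⟩ := q.exists_preimage_norm_le hq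
  choose s hqs hsn using hs
  -- a countable dense subgroup of `Z`
  let K : AddSubgroup Z :=
    (Finsupp.linearCombination ℤ (TopologicalSpace.denseSeq Z)).toAddMonoidHom.range
  have hKc : (K : Set Z).Countable := by
    rw [AddMonoidHom.coe_range]
    exact Set.countable_range _
  have hKd : ∀ z, z ∈ K.topologicalClosure := by
    intro z
    refine closure_mono ?_ (TopologicalSpace.denseRange_denseSeq Z z)
    rintro _ ⟨n, rfl⟩
    exact ⟨Finsupp.single n 1, by simp⟩
  let W : Submodule 𝕜 X := (Submodule.span 𝕜 (s '' (K : Set Z))).topologicalClosure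
  have hWc : IsClosed (W : Set X) := Submodule.isClosed_topologicalClosure _
  have : CompleteSpace W := hWc.completeSpace_coe
  refine ⟨W, hWc, (hKc.image s).isSeparable.span.closure, fun z => ?_⟩
  let g : NormedAddGroupHom W Z :=
    AddMonoidHom.mkNormedAddGroupHom (q.comp W.subtypeL).toLinearMap.toAddMonoidHom
      ‖q.comp W.subtypeL‖ fun w => (q.comp W.subtypeL).le_opNorm w
  have hg : g.SurjectiveOnWith K C := fun k hk =>
    ⟨⟨s k, Submodule.le_topologicalClosure _ (Submodule.subset_span ⟨k, hk, rfl⟩)⟩, hqs k, hsn k⟩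
  obtain ⟨w, hw, -⟩ := controlled_closure_of_complete hC one_pos hg z (hKd z)
  exact ⟨w, w.2, hw⟩

/-- If `Z` is separable, all but countably many coordinates on `c₀(Γ)` extend to `X` by `0` on a
closed separable subspace `W` with `q W = Z`. If `X` is nonseparable, uncountably many remain. -/
theorem IsShortExactSeq.exists_not_countable {Γ : Type uy} [TopologicalSpace Γ]
    [DiscreteTopology Γ] {X : Type ux} [NormedAddCommGroup X] [NormedSpace 𝕜 X]
    [CompleteSpace X] {Z : Type uz} [NormedAddCommGroup Z] [NormedSpace 𝕜 Z] [CompleteSpace Z]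
    [TopologicalSpace.SeparableSpace Z] {i : C₀(Γ, 𝕜) →L[𝕜] X} {q : X →L[𝕜] Z}
    (h : IsShortExactSeq i q) (hsep : ¬ TopologicalSpace.SeparableSpace X) :
    ∃ π : X →L[𝕜] C₀(Γ, 𝕜), ¬ {γ | ∃ x, π x γ ≠ 0}.Countable := by
  classical
  obtain ⟨W, hWc, hWs, hWq⟩ := exists_isSeparable_map_eq_top q h.surjective
  have : CompleteSpace W := hWc.completeSpace_coe
  let p : C₀(Γ, 𝕜) × W →L[𝕜] X := i.coprod W.subtypeL
  have hp : Function.Surjective p := fun x => by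
    obtain ⟨w, hw, hwx⟩ := hWq (q x)
    obtain ⟨y, hy⟩ := (h.exact (x - w)).1 (by rw [map_sub, hwx, sub_self])
    exact ⟨(y, ⟨w, hw⟩), by simp [p, hy]⟩
  let S : Set Γ := {γ | ∃ φ ∈ i ⁻¹' (W : Set X), φ γ ≠ 0}
  have hS : S.Countable := by
    have hr : IsClosed (Set.range i) := by
      have : Set.range i = q ⁻¹' {0} := Set.ext fun x => (h.exact x).symm
      rw [this]
      exact isClosed_singleton.preimage q.continuous
    obtain ⟨_, hanti⟩ := i.antilipschitz_of_injective_of_isClosed_range h.injective hr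
    exact ((hanti.isInducing i.continuous).isSeparable_preimage hWs).countable_iUnion_support
  let mask : C₀(Γ, 𝕜) →L[𝕜] C₀(Γ, 𝕜) :=
    LinearMap.mkContinuous
      { toFun := fun φ => ZeroAtInftyContinuousMap.ofFinite (fun γ => if γ ∈ S then 0 else φ γ)
          fun ε hε => (φ.finite_le_norm hε).subset fun γ hγ => by
            have hγ' : ε ≤ ‖if γ ∈ S then 0 else φ γ‖ := hγ
            split_ifs at hγ' with hγS
            · simp only [norm_zero] at hγ'
              exact absurd hγ' (not_le.2 hε)
            · exact hγ'
        map_add' := fun φ ψ => by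
          ext γ
          by_cases hγ : γ ∈ S <;> simp [hγ]
        map_smul' := fun c φ => by
          ext γ
          by_cases hγ : γ ∈ S <;> simp [hγ] } 1 fun φ => by
      refine ZeroAtInftyContinuousMap.norm_le_of_forall (by positivity) fun γ => ?_
      rw [one_mul]
      change ‖if γ ∈ S then 0 else φ γ‖ ≤ ‖φ‖
      split_ifs
      · simp
      · exact φ.norm_apply_le γ
  have hmask : ∀ φ γ, mask φ γ = if γ ∈ S then 0 else φ γ := fun _ _ => rfl
  obtain ⟨π, hπ⟩ := exists_comp_eq_of_ker_le p hp
    (mask.comp (ContinuousLinearMap.fst 𝕜 C₀(Γ, 𝕜) W)) fun e he => by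
      have hi : i e.1 ∈ W := by
        have : i e.1 = -(e.2 : X) := eq_neg_of_add_eq_zero_left he
        rw [this]
        exact W.neg_mem e.2.2
      ext γ
      change mask e.1 γ = 0
      rw [hmask]
      split_ifs with hγ
      · rfl
      · by_contra hne
        exact hγ ⟨e.1, hi, hne⟩
  refine ⟨π, fun hcount => hsep ?_⟩
  have hΓ : (Set.univ : Set Γ).Countable := by
    refine (hS.union hcount).mono fun γ _ => ?_
    by_cases hγ : γ ∈ S
    · exact Or.inl hγ
    · refine Or.inr ⟨p (c0Single γ, 0), ?_⟩
      rw [hπ]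
      change mask (c0Single γ) γ ≠ 0
      simp [hmask, hγ, c0Single_apply]
  have : Countable Γ := Set.countable_univ_iff.1 hΓ
  have : TopologicalSpace.SeparableSpace C₀(Γ, 𝕜) := separableSpace_c0
  have : TopologicalSpace.SeparableSpace W := hWs.separableSpace
  exact hp.denseRange.separableSpace p.continuous

end NullFamily

/-! ### Twisted sums of `c₀(Γ)` spaces -/

theorem mainTheorem3 (CH : Cardinal.aleph.{0} 1 = Cardinal.continuum.{0})
    {𝕜 : Type uk} [RCLike 𝕜]
    (Γ : ℕ → Type uy) [∀ n, TopologicalSpace (Γ n)] [∀ n, DiscreteTopology (Γ n)]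
    (J₀ : Type uz) [TopologicalSpace J₀] [DiscreteTopology J₀]
    (X : ℕ → Type ux) [∀ n, NormedAddCommGroup (X n)] [∀ n, NormedSpace 𝕜 (X n)]
    [∀ n, CompleteSpace (X n)]
    (hX₀ : IsTwistedSum 𝕜 C₀(Γ 0, 𝕜) C₀(J₀, 𝕜) (X 0))
    (hsep : ¬ TopologicalSpace.SeparableSpace (X 0))
    (hX : ∀ n : ℕ, IsTwistedSum 𝕜 C₀(Γ (n + 1), 𝕜) (X n) (X (n + 1))) :
    ∀ n : ℕ, ¬ ExtEqZero 𝕜 (X n) C₀(ℕ, 𝕜) := by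
  suffices h : ∀ n, HasFewRestrictions 𝕜 (X n) ∧ HasNullFamily 𝕜 (X n) from
    fun n => not_extEqZero_of_hasNullFamily (h n).1 (h n).2
  intro n
  induction n with
  | zero =>
    obtain ⟨i, q, h⟩ := hX₀
    refine ⟨h.hasFewRestrictions (hasFewRestrictions_c0 𝕜 _) (hasFewRestrictions_c0 𝕜 _), ?_⟩
    by_cases hJ : Countable J₀
    · have : TopologicalSpace.SeparableSpace C₀(J₀, 𝕜) := separableSpace_c0
      obtain ⟨π, hπ⟩ := h.exists_not_countable hsep
      exact hasNullFamily_of_not_countable CH π hπ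
    · refine hasNullFamily_of_not_countable CH q fun hcount => hJ ?_
      refine Set.countable_univ_iff.1 (hcount.mono fun γ _ => ?_)
      obtain ⟨x, hx⟩ := h.surjective (c0Single γ)
      exact ⟨x, by simp [hx, c0Single_apply]⟩
  | succ n ih =>
    obtain ⟨i, q, h⟩ := hX n
    exact ⟨h.hasFewRestrictions (hasFewRestrictions_c0 𝕜 _) ih.1,
      ih.2.of_surjective q h.surjective⟩
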